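/- Let $\mu_0$ be a probability measure on the Borel sets of $\mathbb{R}$ having moments of every order, i.e. $\int |x|^n\,d\mu_0<\infty$ for every $n\in\mathbb{N}$. Let $(\mu(\cdot,t))_{t\ge 0}$ be the solution of the Kac equation in Fourier form with initial datum $\mu_0$: each $\mu(\cdot,t)$ is a probability measure on $\mathbb{R}$, $\mu(\cdot,0)=\mu_0$, and the characteristic functions $\varphi(\xi,t)=\int e^{i\xi x}\,\mu(dx,t)$ are, for every $\xi\in\mathbb{R}$, continuous in $t$ at $t=0$ and satisfy $$\frac{\partial\varphi}{\partial t}(\xi,t)=\frac1{2\pi}\int_0^{2\pi}\varphi(\xi\cos\theta,t)\,\varphi(\xi\sin\theta,t)\,d\theta-\varphi(\xi,t)\qquad(t>0).$$ For $\sigma\ge 0$ let $\gamma_\sigma$ be the Gaussian law with mean $0$ and variance $\sigma^2$ (the unit mass at $0$ if $\sigma=0$), and let $d_{TV}(P,Q)=\sup_B|P(B)-Q(B)|$, the supremum being over all Borel sets $B\subseteq\mathbb{R}$. Suppose that for some $\sigma\ge0$ and some constant $C>0$ $$d_{TV}(\mu(\cdot,t),\gamma_\sigma)\le C e^{-t}\qquad\text{for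 all } t\ge 0 .$$ Then $\mu_0=\gamma_\sigma+o_\sigma$, where $o_\sigma$ is a finite signed measure on the Borel sets of $\mathbb{R}$ such that $o_\sigma(A)=-o_\sigma(-A)$ and $\gamma_\sigma(A)+o_\sigma(A)\ge 0$ for every Borel set $A\subseteq\mathbb{R}$. Equivalently, the symmetrization $\tilde\mu_0(B)=\tfrac12\{\mu_0(B)+\mu_0(-B)\}$ of $\mu_0$ is equal to $\gamma_\sigma$. -/

import Mathlib

open MeasureTheory ProbabilityTheory
open scoped Pointwise NNReal ENNReal

noncomputable section

/-- The total variation distance `sup_B |μ(B) - ν(B)|` of two probability measures on the Borel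
sets of `ℝ`. The family is bounded by `1` and nonempty, so the supremum is a genuine one. -/
def tvDistance (μ ν : ProbabilityMeasure ℝ) : ℝ :=
  ⨆ B : {B : Set ℝ // MeasurableSet B},
    |(μ : Measure ℝ).real B.1 - (ν : Measure ℝ).real B.1|

/-- The centred Gaussian law on `ℝ` with variance `σ ^ 2`. -/
def centredGaussian (σ : ℝ≥0) : ProbabilityMeasure ℝ :=
  ⟨gaussianReal 0 (σ ^ 2), inferInstance⟩

/-- The symmetrized form `B ↦ (μ(B) + μ(-B)) / 2` of a probability measure on `ℝ`. -/
def symmetrized (μ : ProbabilityMeasure ℝ) : Measure ℝ :=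
  (2⁻¹ : ℝ≥0∞) • ((μ : Measure ℝ) + (μ : Measure ℝ).map (fun x => -x))

/-- The Wild product `g₁ ⋆ g₂` of two functions on `ℝ`. -/
def wildProduct (g₁ g₂ : ℝ → ℂ) (ξ : ℝ) : ℂ :=
  ((1 / (2 * Real.pi) : ℝ) : ℂ) *
    ∫ θ in (0 : ℝ)..(2 * Real.pi), g₁ (ξ * Real.cos θ) * g₂ (ξ * Real.sin θ)

/-- `μ`, a family of probability measures of which only the members `μ t` with `t ≥ 0` matter,
is a solution of the Fourier-transformed Kac equation
`∂φ/∂t (ξ,t) = (1/2π) ∫_0^{2π} φ(ξ cos θ,t) φ(ξ sin θ,t) dθ - φ(ξ,t)`, for `φ(·,t)` the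
characteristic function of `μ t`, with initial datum `μ₀`. -/
structure IsKacSolution (μ₀ : ProbabilityMeasure ℝ) (μ : ℝ → ProbabilityMeasure ℝ) : Prop where
  initial : μ 0 = μ₀
  continuous_zero : ∀ ξ : ℝ,
    ContinuousWithinAt (fun t => charFun (μ t : Measure ℝ) ξ) (Set.Ici 0) 0
  equation : ∀ ξ t : ℝ, 0 < t →
    HasDerivAt (fun s => charFun (μ s : Measure ℝ) ξ)
      (wildProduct (charFun (μ t : Measure ℝ)) (charFun (μ t : Measure ℝ)) ξ
        - charFun (μ t : Measure ℝ) ξ) t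

end

/-! The real part `u` of the characteristic function solves the Kac equation by itself, and a
centred Gaussian `g` is a stationary solution. Then `z = e^t (u - g)` satisfies `∂z/∂t (ξ) = mean
over θ of z(ξ cos θ) u(ξ sin θ) + g(ξ cos θ) z(ξ sin θ)`. Near `ξ = 0` the coefficients `u`, `g` lie
in `[1/2, 1]`, uniformly in time, so the right side is a positive operator applied to `z`. If some
derivative of `u - g` at `0` were nonzero initially, the first such, of order `n`, would give `u -
g` a constant sign and size at least `c |ξ|^n` near `0`. By comparison (`nonneg_of_deriv_ge`) `z`
would then grow exponentially in `t` (`IsKacSolution.exp_growth`), whereas the assumed rate keeps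
`z` bounded.

Hence all derivatives at `0` agree. The Gaussian has exponential moments, so `u = g` initially
(`reCharFun_eq_of_iteratedDeriv_eq`), and `u` is the characteristic function of the symmetrization.
-/

/-! ### Comparison principle -/

/-- A comparison principle for evolutions `∂z/∂t = L z` with `L` positive and `L 1 ≤ 2`: nonnegative
initial data stay nonnegative. The operator enters only through lower bounds of `L z`. -/
theorem nonneg_of_deriv_ge {ι : Type*} {S : Set ι} {T B : ℝ} {z z' : ι → ℝ → ℝ}
    (hT : 0 ≤ T)
    (hcont : ∀ i ∈ S, ContinuousOn (z i) (Set.Icc 0 T))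
    (hder : ∀ i ∈ S, ∀ t ∈ Set.Ioo 0 T, HasDerivAt (z i) (z' i t) t)
    (hpos : ∀ t ∈ Set.Ioo 0 T, ∀ m : ℝ, 0 ≤ m → (∀ j ∈ S, -m ≤ z j t) →
      ∀ i ∈ S, -(2 * m) ≤ z' i t)
    (hinit : ∀ i ∈ S, 0 ≤ z i 0)
    (hB : 0 ≤ B) (hbound : ∀ i ∈ S, ∀ t ∈ Set.Icc 0 T, -B ≤ z i t) :
    ∀ i ∈ S, 0 ≤ z i T := by
  -- Picard-type iteration: integrating `z' ≥ -2m` in time improves the crude bound `-B` to `-B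
  -- (2t)^n / n!`, which tends to `0`.
  have key : ∀ n : ℕ, ∀ i ∈ S, ∀ t ∈ Set.Icc 0 T,
      -(B * (2 * t) ^ n / n.factorial) ≤ z i t := by
    intro n
    induction n with
    | zero => simpa using hbound
    | succ n ih =>
      intro i hi t ht
      have hp : ∀ s : ℝ, HasDerivAt (fun s : ℝ => B * (2 * s) ^ (n + 1) / (n + 1).factorial)
          (2 * (B * (2 * s) ^ n / n.factorial)) s := by
        intro s
        have h1 : HasDerivAt (fun s : ℝ => 2 * s) 2 s := by
          simpa using (hasDerivAt_id s).const_mul (2 : ℝ)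
        have h := ((h1.pow (n + 1)).const_mul B).div_const ((n + 1).factorial : ℝ)
        refine h.congr_deriv ?_
        have : ((n.factorial : ℕ) : ℝ) ≠ 0 := by positivity
        rw [Nat.factorial_succ]
        push_cast
        field_simp
      have hmono : MonotoneOn
          (fun s => z i s + B * (2 * s) ^ (n + 1) / (n + 1).factorial) (Set.Icc 0 T) := by
        refine monotoneOn_of_deriv_nonneg (convex_Icc 0 T)
          ((hcont i hi).add (fun s _ => (hp s).continuousAt.continuousWithinAt)) ?_ ?_
        · rw [interior_Icc]
          exact fun s hs => ((hder i hi s hs).add (hp s)).differentiableAt.differentiableWithinAt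
        · rw [interior_Icc]
          intro s hs
          have h2 : deriv (fun s => z i s + B * (2 * s) ^ (n + 1) / (n + 1).factorial) s = _ :=
            ((hder i hi s hs).add (hp s)).deriv
          rw [h2]
          have hs0 : 0 < s := hs.1
          have := hpos s hs (B * (2 * s) ^ n / n.factorial) (by positivity)
            (fun j hj => ih j hj s ⟨hs.1.le, hs.2.le⟩) i hi
          linarith
      have h3 := hmono (Set.left_mem_Icc.2 hT) ht ht.1
      have h4 := hinit i hi
      simp only [mul_zero, ne_eq, Nat.add_eq_zero_iff, one_ne_zero, and_false, not_false_eq_true,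
        zero_pow, zero_div, add_zero] at h3
      linarith
  intro i hi
  have hlim : Filter.Tendsto (fun n : ℕ => -(B * (2 * T) ^ n / n.factorial)) Filter.atTop
      (nhds 0) := by
    have := ((FloorSemiring.tendsto_pow_div_factorial_atTop (2 * T)).const_mul B).neg
    simpa [mul_div_assoc] using this
  exact le_of_tendsto' hlim fun n => key n i hi T (Set.right_mem_Icc.2 hT)

/-! ### Angular means and real parts of characteristic functions -/

/-- The mean of a function over a period of the angle. -/
noncomputable def angularMean (F : ℝ → ℝ) : ℝ := 1 / (2 * Real.pi) * ∫ θ in (0 : ℝ)..(2 * Real.pi), F θ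

theorem le_angularMean {F : ℝ → ℝ} (hF : Continuous F) {c : ℝ} (h : ∀ θ, c ≤ F θ) :
    c ≤ angularMean F := by
  have hpi := Real.pi_pos
  have h1 : ∫ _ in (0 : ℝ)..(2 * Real.pi), c ≤ ∫ θ in (0 : ℝ)..(2 * Real.pi), F θ :=
    intervalIntegral.integral_mono_on (by positivity) (by simp) (hF.intervalIntegrable _ _)
      fun θ _ => h θ
  rw [intervalIntegral.integral_const, smul_eq_mul, sub_zero] at h1
  rw [angularMean, one_div, inv_mul_eq_div, le_div_iff₀ (by positivity)]
  linarith

theorem angularMean_const (c : ℝ) : angularMean (fun _ => c) = c := by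
  rw [angularMean, intervalIntegral.integral_const, smul_eq_mul, sub_zero]
  field_simp

theorem angularMean_sub {F G : ℝ → ℝ} (hF : Continuous F) (hG : Continuous G) :
    angularMean (fun θ => F θ - G θ) = angularMean F - angularMean G := by
  rw [angularMean, angularMean, angularMean, intervalIntegral.integral_sub
    (hF.intervalIntegrable _ _) (hG.intervalIntegrable _ _), mul_sub]

theorem angularMean_const_mul (c : ℝ) (F : ℝ → ℝ) :
    angularMean (fun θ => c * F θ) = c * angularMean F := by
  rw [angularMean, angularMean, intervalIntegral.integral_const_mul]
  ring

/-- The real part of the characteristic function of a measure on `ℝ`. -/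
noncomputable def reCharFun (P : Measure ℝ) (ξ : ℝ) : ℝ := (charFun P ξ).re

section reCharFun

variable (P : Measure ℝ)

theorem reCharFun_neg (ξ : ℝ) : reCharFun P (-ξ) = reCharFun P ξ := by
  simp [reCharFun, charFun_neg]

variable [IsProbabilityMeasure P]

theorem reCharFun_eq_integral (ξ : ℝ) : reCharFun P ξ = ∫ x, Real.cos (ξ * x) ∂P := by
  rw [reCharFun, charFun_apply_real, ← RCLike.re_eq_complex_re, ← integral_re]
  · congr 1 with x
    rw [RCLike.re_eq_complex_re, show (ξ : ℂ) * x * Complex.I = ((ξ * x : ℝ) : ℂ) * Complex.I by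
      push_cast; ring, Complex.exp_ofReal_mul_I_re]
  · refine (integrable_const (1 : ℝ)).mono' (by fun_prop) (Filter.Eventually.of_forall fun x => ?_)
    rw [show (ξ : ℂ) * x * Complex.I = ((ξ * x : ℝ) : ℂ) * Complex.I by push_cast; ring,
      Complex.norm_exp_ofReal_mul_I]

theorem continuous_reCharFun : Continuous (reCharFun P) :=
  Complex.continuous_re.comp continuous_charFun

theorem reCharFun_zero : reCharFun P 0 = 1 := by simp [reCharFun]

theorem abs_reCharFun_le_one (ξ : ℝ) : |reCharFun P ξ| ≤ 1 :=
  (Complex.abs_re_le_norm _).trans (norm_charFun_le_one ξ)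

theorem integrable_cos_mul (ξ : ℝ) : Integrable (fun x => Real.cos (ξ * x)) P :=
  (integrable_const (1 : ℝ)).mono' (by fun_prop)
    (Filter.Eventually.of_forall fun x => Real.abs_cos_le_one _)

theorem one_sub_le_reCharFun (h2 : Integrable (fun x : ℝ => x ^ 2) P) (ξ : ℝ) :
    1 - (∫ x, x ^ 2 ∂P) / 2 * ξ ^ 2 ≤ reCharFun P ξ := by
  rw [reCharFun_eq_integral]
  have h : ∫ x, (1 - ξ ^ 2 / 2 * x ^ 2) ∂P ≤ ∫ x, Real.cos (ξ * x) ∂P := by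
    refine integral_mono ((integrable_const 1).sub (h2.const_mul _)) (integrable_cos_mul P ξ) ?_
    intro x
    have := Real.one_sub_sq_div_two_le_cos (x := ξ * x)
    simp only
    nlinarith
  rw [integral_sub (integrable_const 1) (h2.const_mul _), integral_const_mul] at h
  simp only [integral_const, probReal_univ, smul_eq_mul, mul_one] at h
  linarith

end reCharFun

/-! ### Total variation controls characteristic functions -/

theorem abs_measureReal_sub_le_tvDistance (μ ν : ProbabilityMeasure ℝ) {B : Set ℝ}
    (hB : MeasurableSet B) :
    |(μ : Measure ℝ).real B - (ν : Measure ℝ).real B| ≤ tvDistance μ ν := by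
  refine le_ciSup (f := fun B : {B : Set ℝ // MeasurableSet B} =>
    |(μ : Measure ℝ).real B.1 - (ν : Measure ℝ).real B.1|) ⟨1, ?_⟩ ⟨B, hB⟩
  rintro _ ⟨A, rfl⟩
  exact abs_sub_le_of_le_of_le measureReal_nonneg measureReal_le_one measureReal_nonneg
    measureReal_le_one |>.trans (by norm_num)

/-- Layer cake: each superlevel set contributes at most the distance, and the levels fill an
interval of length `1`. -/
theorem abs_integral_sub_le_tvDistance (μ ν : ProbabilityMeasure ℝ) {f : ℝ → ℝ}
    (hf : Measurable f) (h0 : ∀ x, 0 ≤ f x) (h1 : ∀ x, f x ≤ 1) :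
    |∫ x, f x ∂(μ : Measure ℝ) - ∫ x, f x ∂(ν : Measure ℝ)| ≤ tvDistance μ ν := by
  have hint : ∀ P : ProbabilityMeasure ℝ, Integrable f (P : Measure ℝ) := fun P =>
    (integrable_const (1 : ℝ)).mono' hf.aestronglyMeasurable
      (Filter.Eventually.of_forall fun x => by
        rw [Real.norm_eq_abs, abs_of_nonneg (h0 x)]; exact h1 x)
  have hlayer : ∀ P : ProbabilityMeasure ℝ, ∫ x, f x ∂(P : Measure ℝ) =
      ∫ t in Set.Ioc (0 : ℝ) 1, (P : Measure ℝ).real {a | t ≤ f a} := fun P =>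
    (hint P).integral_eq_integral_Ioc_meas_le (Filter.Eventually.of_forall h0)
      (Filter.Eventually.of_forall h1)
  have hanti : ∀ P : ProbabilityMeasure ℝ,
      IntegrableOn (fun t => (P : Measure ℝ).real {a | t ≤ f a}) (Set.Ioc (0 : ℝ) 1) := by
    intro P
    have : Antitone (fun t => (P : Measure ℝ).real {a | t ≤ f a}) := fun s t hst =>
      measureReal_mono fun a ha => le_trans hst ha
    exact ((this.antitoneOn _).integrableOn_isCompact isCompact_Icc).mono_set
      Set.Ioc_subset_Icc_self
  rw [hlayer, hlayer, ← integral_sub (hanti μ) (hanti ν), ← Real.norm_eq_abs]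
  have := norm_setIntegral_le_of_norm_le_const (μ := volume) (s := Set.Ioc (0 : ℝ) 1)
    (f := fun t => (μ : Measure ℝ).real {a | t ≤ f a} - (ν : Measure ℝ).real {a | t ≤ f a})
    (C := tvDistance μ ν) (by simp) (fun t _ =>
      abs_measureReal_sub_le_tvDistance μ ν (measurableSet_le measurable_const hf))
  simpa using this

theorem abs_reCharFun_sub_le_tvDistance (μ ν : ProbabilityMeasure ℝ) (ξ : ℝ) :
    |reCharFun μ ξ - reCharFun ν ξ| ≤ 2 * tvDistance μ ν := by
  -- The cosine is rescaled into `[0, 1]`; undoing this gives the factor `2`.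
  have h := abs_integral_sub_le_tvDistance μ ν (f := fun x => (1 + Real.cos (ξ * x)) / 2)
    (by fun_prop) (fun x => by linarith [Real.neg_one_le_cos (ξ * x)])
    (fun x => by linarith [Real.cos_le_one (ξ * x)])
  have hP : ∀ P : ProbabilityMeasure ℝ, ∫ x, (1 + Real.cos (ξ * x)) / 2 ∂(P : Measure ℝ) =
      (1 + reCharFun P ξ) / 2 := by
    intro P
    rw [integral_div, integral_add (integrable_const 1) (integrable_cos_mul _ ξ),
      reCharFun_eq_integral]
    simp
  rw [hP, hP, show (1 + reCharFun μ ξ) / 2 - (1 + reCharFun ν ξ) / 2 =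
    (reCharFun μ ξ - reCharFun ν ξ) / 2 by ring, abs_div, abs_two] at h
  linarith

/-! ### The Kac equation for the real part -/

/-- The product of imaginary parts drops out: the imaginary part is odd, so `θ ↦ 2π - θ` changes the
sign of that term. -/
theorem re_wildProduct_charFun (P : Measure ℝ) [IsProbabilityMeasure P] (ξ : ℝ) :
    (wildProduct (charFun P) (charFun P) ξ).re =
      angularMean fun θ => reCharFun P (ξ * Real.cos θ) * reCharFun P (ξ * Real.sin θ) := by
  have hc : Continuous (charFun P) := continuous_charFun
  have hre : Continuous (reCharFun P) := continuous_reCharFun P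
  set J : ℝ → ℝ := fun η => (charFun P η).im with hJ
  have hJc : Continuous J := Complex.continuous_im.comp hc
  have hodd : ∀ η, J (-η) = -J η := fun η => by simp [hJ, charFun_neg]
  set F : ℝ → ℝ := fun θ => J (ξ * Real.cos θ) * J (ξ * Real.sin θ) with hF
  have hzero : ∫ θ in (0 : ℝ)..(2 * Real.pi), F θ = 0 := by
    have h1 := intervalIntegral.integral_comp_sub_left F (a := 0) (b := 2 * Real.pi)
      (2 * Real.pi)
    have h2 : (fun θ => F (2 * Real.pi - θ)) = fun θ => -F θ := by
      funext θ
      simp only [hF, Real.cos_two_pi_sub, Real.sin_two_pi_sub, mul_neg, hodd]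
    rw [h2, intervalIntegral.integral_neg, sub_self, sub_zero] at h1
    linarith
  have hint : IntervalIntegrable (fun θ => charFun P (ξ * Real.cos θ) *
      charFun P (ξ * Real.sin θ)) volume 0 (2 * Real.pi) :=
    Continuous.intervalIntegrable (by fun_prop) _ _
  rw [wildProduct, Complex.re_ofReal_mul, angularMean]
  congr 1
  have h3 := Complex.reCLM.intervalIntegral_comp_comm hint
  simp only [Complex.reCLM_apply, Complex.mul_re] at h3
  rw [← h3, intervalIntegral.integral_sub]
  · change _ - ∫ θ in (0 : ℝ)..(2 * Real.pi), F θ = _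
    rw [hzero, sub_zero]
    rfl
  · exact Continuous.intervalIntegrable (u := fun θ => reCharFun P (ξ * Real.cos θ) *
      reCharFun P (ξ * Real.sin θ)) (by fun_prop) _ _
  · exact Continuous.intervalIntegrable (u := F) (by fun_prop) _ _

section KacSolution

variable {μ₀ : ProbabilityMeasure ℝ} {μ : ℝ → ProbabilityMeasure ℝ}

theorem IsKacSolution.hasDerivAt_reCharFun (hsol : IsKacSolution μ₀ μ) (ξ : ℝ) {t : ℝ}
    (ht : 0 < t) :
    HasDerivAt (fun s => reCharFun (μ s) ξ)
      (angularMean (fun θ => reCharFun (μ t) (ξ * Real.cos θ) *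
        reCharFun (μ t) (ξ * Real.sin θ)) - reCharFun (μ t) ξ) t := by
  have h := Complex.reCLM.hasFDerivAt.comp_hasDerivAt t (hsol.equation ξ t ht)
  rw [← re_wildProduct_charFun]
  exact h

theorem IsKacSolution.continuousOn_reCharFun (hsol : IsKacSolution μ₀ μ) (ξ : ℝ) :
    ContinuousOn (fun s => reCharFun (μ s) ξ) (Set.Ici 0) := by
  intro t ht
  rcases (Set.mem_Ici.1 ht).eq_or_lt with rfl | ht'
  · exact Complex.continuous_re.continuousAt.comp_continuousWithinAt (hsol.continuous_zero ξ)
  · exact (hsol.hasDerivAt_reCharFun ξ ht').continuousAt.continuousWithinAt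

theorem sq_cos_add_sq_sin (ξ θ : ℝ) :
    (ξ * Real.cos θ) ^ 2 + (ξ * Real.sin θ) ^ 2 = ξ ^ 2 := by
  linear_combination ξ ^ 2 * Real.sin_sq_add_cos_sq θ

/-- A quadratic lower bound of the real part of the characteristic function propagates in time. -/
theorem IsKacSolution.one_sub_le_reCharFun (hsol : IsKacSolution μ₀ μ) {A : ℝ}
    (hA : ∀ ξ, 1 - A * ξ ^ 2 ≤ reCharFun μ₀ ξ) {T : ℝ} (hT : 0 ≤ T) (ξ : ℝ) :
    1 - A * ξ ^ 2 ≤ reCharFun (μ T) ξ := by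
  have hA0 : 0 ≤ A := by
    have := hA 1
    have := (abs_le.1 (abs_reCharFun_le_one (μ₀ : Measure ℝ) 1)).2
    linarith
  -- The weight `e^t` absorbs the loss term `-φ`, leaving only the gain term in the derivative.
  have main := nonneg_of_deriv_ge (S := (Set.univ : Set ℝ)) (T := T)
    (B := 2 * Real.exp T)
    (z := fun η t => Real.exp t * (reCharFun (μ t) η - (1 - A * η ^ 2)))
    (z' := fun η t => Real.exp t * (angularMean (fun θ => reCharFun (μ t) (η * Real.cos θ) *
        reCharFun (μ t) (η * Real.sin θ)) - (1 - A * η ^ 2)))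
    hT ?_ ?_ ?_ ?_ (by positivity) ?_ ξ (Set.mem_univ _)
  · have := nonneg_of_mul_nonneg_right main (Real.exp_pos T)
    linarith
  · intro η _
    exact Real.continuous_exp.continuousOn.mul
      (((hsol.continuousOn_reCharFun η).mono Set.Icc_subset_Ici_self).sub continuousOn_const)
  · intro η _ t ht
    refine ((Real.hasDerivAt_exp t).mul
      ((hsol.hasDerivAt_reCharFun η ht.1).sub_const _)).congr_deriv ?_
    ring
  · intro t ht m hm hz η _
    have hc := continuous_reCharFun (μ t : Measure ℝ)
    have h1 := le_angularMean (c := 1 - A * η ^ 2 - 2 * (Real.exp (-t) * m))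
      (F := fun θ => reCharFun (μ t) (η * Real.cos θ) * reCharFun (μ t) (η * Real.sin θ))
      (by fun_prop) ?_
    · have h2 := mul_le_mul_of_nonneg_left h1 (Real.exp_pos t).le
      have h3 : Real.exp t * Real.exp (-t) = 1 := by rw [← Real.exp_add]; simp
      linear_combination h2 + 2 * m * h3
    · intro θ
      have hlow : ∀ ζ, 1 - A * ζ ^ 2 - Real.exp (-t) * m ≤ reCharFun (μ t) ζ := by
        intro ζ
        have h2 := mul_le_mul_of_nonneg_left (hz ζ (Set.mem_univ _)) (Real.exp_pos (-t)).le
        have h3 : Real.exp (-t) * Real.exp t = 1 := by rw [← Real.exp_add]; simp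
        rw [← mul_assoc, h3, one_mul] at h2
        linarith
      have ha := hlow (η * Real.cos θ)
      have hb := hlow (η * Real.sin θ)
      have ha1 := (abs_le.1 (abs_reCharFun_le_one (μ t : Measure ℝ) (η * Real.cos θ))).2
      have hb1 := (abs_le.1 (abs_reCharFun_le_one (μ t : Measure ℝ) (η * Real.sin θ))).2
      have hsq := sq_cos_add_sq_sin η θ
      -- From `(1 - a)(1 - b) ≥ 0` comes `ab ≥ a + b - 1`; the quadratic terms then add up to `A
      -- η²`.
      nlinarith [mul_nonneg (sub_nonneg.2 ha1) (sub_nonneg.2 hb1)]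
  · intro η _
    have := hA η
    simp only [Real.exp_zero, one_mul, hsol.initial]
    linarith
  · intro η _ t ht
    have h1 := (abs_le.1 (abs_reCharFun_le_one (μ t : Measure ℝ) η)).1
    have h2 : Real.exp t ≤ Real.exp T := Real.exp_le_exp.2 ht.2
    have h3 := Real.exp_pos t
    have h4 : 0 ≤ A * η ^ 2 := by positivity
    nlinarith

end KacSolution

/-! ### The stationary Gaussian -/

section Gaussian

variable (σ : ℝ≥0)

theorem charFun_centredGaussian (ξ : ℝ) :
    charFun (centredGaussian σ : Measure ℝ) ξ =
      ((Real.exp (-((σ : ℝ) ^ 2 / 2 * ξ ^ 2)) : ℝ) : ℂ) := by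
  change charFun (gaussianReal 0 (σ ^ 2)) ξ = _
  rw [charFun_gaussianReal]
  push_cast
  congr 1
  ring

theorem reCharFun_centredGaussian (ξ : ℝ) :
    reCharFun (centredGaussian σ) ξ = Real.exp (-((σ : ℝ) ^ 2 / 2 * ξ ^ 2)) := by
  rw [reCharFun, charFun_centredGaussian, Complex.ofReal_re]

theorem reCharFun_centredGaussian_mul (ξ θ : ℝ) :
    reCharFun (centredGaussian σ) (ξ * Real.cos θ) *
      reCharFun (centredGaussian σ) (ξ * Real.sin θ) = reCharFun (centredGaussian σ) ξ := by
  rw [reCharFun_centredGaussian, reCharFun_centredGaussian, reCharFun_centredGaussian,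
    ← Real.exp_add, ← sq_cos_add_sq_sin ξ θ]
  congr 1
  ring

theorem one_sub_le_reCharFun_centredGaussian (ξ : ℝ) :
    1 - (σ : ℝ) ^ 2 / 2 * ξ ^ 2 ≤ reCharFun (centredGaussian σ) ξ := by
  rw [reCharFun_centredGaussian]
  linarith [Real.add_one_le_exp (-((σ : ℝ) ^ 2 / 2 * ξ ^ 2))]

end Gaussian

/-! ### Exponential growth of a deviation -/

/-- Since `cos² + sin² = 1`, one of the two is at least `1/2` in absolute value. This fixes the
growth rate below. -/
theorem two_pow_le_abs_cos_pow_add_abs_sin_pow (n : ℕ) (θ : ℝ) :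
    ((1 / 2 : ℝ)) ^ n ≤ |Real.cos θ| ^ n + |Real.sin θ| ^ n := by
  by_cases h : 1 / 2 ≤ |Real.cos θ|
  · have := pow_le_pow_left₀ (by norm_num) h n
    have : 0 ≤ |Real.sin θ| ^ n := by positivity
    linarith
  · have hs : 1 / 2 ≤ |Real.sin θ| := by
      by_contra hs
      push Not at h hs
      have := Real.sin_sq_add_cos_sq θ
      rw [← sq_abs, ← sq_abs (Real.cos θ)] at this
      nlinarith [abs_nonneg (Real.sin θ), abs_nonneg (Real.cos θ)]
    have := pow_le_pow_left₀ (by norm_num) hs n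
    have : 0 ≤ |Real.cos θ| ^ n := by positivity
    linarith

theorem abs_mul_cos_le {ξ δ : ℝ} (h : |ξ| ≤ δ) (θ : ℝ) : |ξ * Real.cos θ| ≤ δ := by
  rw [abs_mul]
  exact (mul_le_of_le_one_right (abs_nonneg _) (Real.abs_cos_le_one θ)).trans h

theorem abs_mul_sin_le {ξ δ : ℝ} (h : |ξ| ≤ δ) (θ : ℝ) : |ξ * Real.sin θ| ≤ δ := by
  rw [abs_mul]
  exact (mul_le_of_le_one_right (abs_nonneg _) (Real.abs_sin_le_one θ)).trans h

/-- If the real part of the initial characteristic function deviates from the Gaussian one by at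
least `c |ξ| ^ n` near the origin, with constant sign `s`, then the deviation, rescaled by `e ^ t`,
grows exponentially. -/
theorem IsKacSolution.exp_growth {μ₀ : ProbabilityMeasure ℝ} {μ : ℝ → ProbabilityMeasure ℝ}
    (hsol : IsKacSolution μ₀ μ) {σ : ℝ≥0} {δ c s : ℝ} {n : ℕ} (hc : 0 ≤ c) (hs : |s| = 1)
    (hδ : ∀ t, 0 ≤ t → ∀ ξ, |ξ| ≤ δ → 1 / 2 ≤ reCharFun (μ t) ξ)
    (hδg : ∀ ξ, |ξ| ≤ δ → 1 / 2 ≤ reCharFun (centredGaussian σ) ξ)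
    (hinit : ∀ ξ, |ξ| ≤ δ →
      c * |ξ| ^ n ≤ s * (reCharFun μ₀ ξ - reCharFun (centredGaussian σ) ξ))
    {T : ℝ} (hT : 0 ≤ T) {ξ : ℝ} (hξ : |ξ| ≤ δ) :
    c * |ξ| ^ n * Real.exp ((1 / 2) ^ (n + 1) * T) ≤
      Real.exp T * (s * (reCharFun (μ T) ξ - reCharFun (centredGaussian σ) ξ)) := by
  set g : ℝ → ℝ := reCharFun (centredGaussian σ) with hg
  -- A factor `1/2` from the coefficients `u`, `g`, and `2^(-n)` from `|cos θ|^n + |sin θ|^n`.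
  set β : ℝ := (1 / 2) ^ (n + 1) with hβ
  have hβ0 : 0 < β := by positivity
  have hgc : Continuous g := continuous_reCharFun _
  have hle : ∀ (P : ProbabilityMeasure ℝ) η, |reCharFun P η| ≤ 1 := fun P η =>
    abs_reCharFun_le_one _ η
  have main := nonneg_of_deriv_ge (S := {η : ℝ | |η| ≤ δ}) (T := T)
    (B := 2 * Real.exp T + c * δ ^ n * Real.exp (β * T))
    (z := fun η t => Real.exp t * (s * (reCharFun (μ t) η - g η)) -
      c * |η| ^ n * Real.exp (β * t))
    (z' := fun η t => Real.exp t * (s * (angularMean (fun θ =>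
      reCharFun (μ t) (η * Real.cos θ) * reCharFun (μ t) (η * Real.sin θ)) - g η)) -
      c * |η| ^ n * (β * Real.exp (β * t)))
    hT ?_ ?_ ?_ ?_ ?_ ?_ ξ hξ
  · linarith
  · intro η _
    have := (hsol.continuousOn_reCharFun η).mono
      (Set.Icc_subset_Ici_self : Set.Icc 0 T ⊆ Set.Ici 0)
    fun_prop
  · intro η _ t ht
    have h1 : HasDerivAt (fun t => Real.exp (β * t)) (β * Real.exp (β * t)) t := by
      have := ((hasDerivAt_id t).const_mul β).exp
      simpa [mul_comm] using this
    refine (((Real.hasDerivAt_exp t).mul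
      (((hsol.hasDerivAt_reCharFun η ht.1).sub_const (g η)).const_mul s)).sub
      (h1.const_mul (c * |η| ^ n))).congr_deriv ?_
    ring
  · intro t ht m hm hz η hη
    have hψc := continuous_reCharFun (μ t : Measure ℝ)
    set ψ : ℝ → ℝ := reCharFun (μ t) with hψ
    -- Stationarity allows `g η` to be written as the mean of `g(η cos θ) g(η sin θ)`.
    have hmean : Real.exp t * (s * (angularMean (fun θ =>
        ψ (η * Real.cos θ) * ψ (η * Real.sin θ)) - g η)) =
        angularMean fun θ => Real.exp t * s * (ψ (η * Real.cos θ) * ψ (η * Real.sin θ) -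
          g (η * Real.cos θ) * g (η * Real.sin θ)) := by
      rw [angularMean_const_mul, angularMean_sub (by fun_prop) (by fun_prop)]
      simp only [hg, reCharFun_centredGaussian_mul, angularMean_const]
      ring
    rw [hmean, neg_le_sub_iff_le_add]
    have h1 := le_angularMean (c := c * |η| ^ n * (β * Real.exp (β * t)) - 2 * m)
      (F := fun θ => Real.exp t * s * (ψ (η * Real.cos θ) * ψ (η * Real.sin θ) -
          g (η * Real.cos θ) * g (η * Real.sin θ))) (by fun_prop) ?_
    · linarith
    intro θ
    set E := c * |η| ^ n * Real.exp (β * t) with hE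
    have hE0 : 0 ≤ E := by positivity
    have hcos := hz _ (abs_mul_cos_le hη θ)
    have hsin := hz _ (abs_mul_sin_le hη θ)
    rw [abs_mul, mul_pow] at hcos hsin
    have hcos' : E * |Real.cos θ| ^ n - m ≤
        Real.exp t * (s * (ψ (η * Real.cos θ) - g (η * Real.cos θ))) := by
      linarith
    have hsin' : E * |Real.sin θ| ^ n - m ≤
        Real.exp t * (s * (ψ (η * Real.sin θ) - g (η * Real.sin θ))) := by
      linarith
    -- With `ψ, g` at `η cos θ`, `ψ', g'` at `η sin θ`: `ψψ' - gg' = (ψ - g)ψ' + g(ψ' - g')`. The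
    -- bound `1/2 ≤ ψ', g` serves the growing term, `ψ', g ≤ 1` the error `m`.
    have hp1 := hδ t ht.1.le _ (abs_mul_sin_le hη θ)
    have hp2 := hδg _ (abs_mul_cos_le hη θ)
    have hq1 := (abs_le.1 (hle (μ t) (η * Real.sin θ))).2
    have hq2 := (abs_le.1 (hle (centredGaussian σ) (η * Real.cos θ))).2
    have k1 := mul_le_mul_of_nonneg_right hcos' (le_trans (by norm_num) hp1)
    have k2 := mul_le_mul_of_nonneg_right hsin' (le_trans (by norm_num) hp2)
    have k3 := mul_le_mul_of_nonneg_left hp1 (by positivity : 0 ≤ E * |Real.cos θ| ^ n)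
    have k4 := mul_le_mul_of_nonneg_left hp2 (by positivity : 0 ≤ E * |Real.sin θ| ^ n)
    have k5 := mul_le_mul_of_nonneg_left hq1 hm
    have k6 := mul_le_mul_of_nonneg_left hq2 hm
    have k7 := mul_le_mul_of_nonneg_left (two_pow_le_abs_cos_pow_add_abs_sin_pow n θ) hE0
    have k8 : c * |η| ^ n * (β * Real.exp (β * t)) = E * (1 / 2) ^ n / 2 := by
      rw [hE, hβ, pow_succ]; ring
    rw [k8]
    simp only [← hψ, ← hg] at *
    linarith
  · intro η hη
    have := hinit η hη
    simp only [Real.exp_zero, one_mul, mul_zero, mul_one, hsol.initial]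
    linarith
  · have : 0 ≤ δ := (abs_nonneg ξ).trans hξ
    positivity
  · intro η hη t ht
    have h1 : |s * (reCharFun (μ t) η - g η)| ≤ 2 := by
      rw [abs_mul, hs, one_mul]
      exact (abs_sub _ _).trans (by linarith [hle (μ t) η, hle (centredGaussian σ) η])
    have h2 : Real.exp t ≤ Real.exp T := Real.exp_le_exp.2 ht.2
    have h3 : Real.exp (β * t) ≤ Real.exp (β * T) :=
      Real.exp_le_exp.2 (mul_le_mul_of_nonneg_left ht.2 hβ0.le)
    have hδ0 : 0 ≤ δ := (abs_nonneg ξ).trans hξ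
    have h4 : |η| ^ n ≤ δ ^ n := pow_le_pow_left₀ (abs_nonneg _) hη n
    have h5 : c * |η| ^ n * Real.exp (β * t) ≤ c * δ ^ n * Real.exp (β * T) := by
      gcongr
    have h6 := (abs_le.1 h1).1
    have h7 := Real.exp_pos t
    nlinarith

/-- Convergence at rate `e ^ (-t)` excludes an initial deviation of constant sign and of order
`|ξ| ^ n` at the origin. -/
theorem IsKacSolution.not_deviation {μ₀ : ProbabilityMeasure ℝ} {μ : ℝ → ProbabilityMeasure ℝ}
    (hsol : IsKacSolution μ₀ μ) {σ : ℝ≥0} (h2 : Integrable (fun x : ℝ => x ^ 2) (μ₀ : Measure ℝ))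
    {C : ℝ} (hrate : ∀ t : ℝ, 0 ≤ t → tvDistance (μ t) (centredGaussian σ) ≤ C * Real.exp (-t))
    {δ c s : ℝ} {n : ℕ} (hδ : 0 < δ) (hc : 0 < c) (hs : |s| = 1)
    (hinit : ∀ ξ, |ξ| ≤ δ →
      c * |ξ| ^ n ≤ s * (reCharFun μ₀ ξ - reCharFun (centredGaussian σ) ξ)) : False := by
  -- One constant for both quadratic lower bounds, so that a single `ε` keeps `u` and `g` above
  -- `1/2`.
  set A : ℝ := max ((∫ x, x ^ 2 ∂(μ₀ : Measure ℝ)) / 2) ((σ : ℝ) ^ 2 / 2) with hA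
  have hA0 : 0 ≤ A := le_max_of_le_right (by positivity)
  have hlow : ∀ ξ, 1 - A * ξ ^ 2 ≤ reCharFun μ₀ ξ := fun ξ => by
    have := _root_.one_sub_le_reCharFun (μ₀ : Measure ℝ) h2 ξ
    nlinarith [le_max_left ((∫ x, x ^ 2 ∂(μ₀ : Measure ℝ)) / 2) ((σ : ℝ) ^ 2 / 2), sq_nonneg ξ]
  have hlowg : ∀ ξ, 1 - A * ξ ^ 2 ≤ reCharFun (centredGaussian σ) ξ := fun ξ => by
    have := one_sub_le_reCharFun_centredGaussian σ ξ
    nlinarith [le_max_right ((∫ x, x ^ 2 ∂(μ₀ : Measure ℝ)) / 2) ((σ : ℝ) ^ 2 / 2), sq_nonneg ξ]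
  obtain ⟨ε, hε0, hεδ, hε⟩ : ∃ ε : ℝ, 0 < ε ∧ ε ≤ δ ∧ A * ε ^ 2 ≤ 1 / 2 := by
    refine ⟨min δ (1 / (2 * A + 1)), by positivity, min_le_left _ _, ?_⟩
    have h1 : min δ (1 / (2 * A + 1)) ≤ 1 / (2 * A + 1) := min_le_right _ _
    have h0 : 0 ≤ min δ (1 / (2 * A + 1)) := by positivity
    have h3 : A * (1 / (2 * A + 1)) ^ 2 ≤ 1 / 2 := by
      rw [one_div, inv_pow, mul_inv_le_iff₀ (by positivity)]
      nlinarith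
    exact (mul_le_mul_of_nonneg_left (pow_le_pow_left₀ h0 h1 2) hA0).trans h3
  have hsmall : ∀ ξ, |ξ| ≤ ε → A * ξ ^ 2 ≤ 1 / 2 := fun ξ hξ => by
    have : ξ ^ 2 ≤ ε ^ 2 := sq_le_sq' (abs_le.1 hξ).1 (abs_le.1 hξ).2
    exact (mul_le_mul_of_nonneg_left this hA0).trans hε
  have hbound : ∀ T, 0 ≤ T → c * ε ^ n * Real.exp ((1 / 2) ^ (n + 1) * T) ≤ 2 * C := by
    intro T hT
    have h := hsol.exp_growth (δ := ε) hc.le hs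
      (fun t ht ξ hξ => by linarith [hsol.one_sub_le_reCharFun hlow ht ξ, hsmall ξ hξ])
      (fun ξ hξ => by linarith [hlowg ξ, hsmall ξ hξ])
      (fun ξ hξ => hinit ξ (hξ.trans hεδ)) hT (abs_of_pos hε0).le
    rw [abs_of_pos hε0] at h
    refine h.trans ?_
    have h1 : s * (reCharFun (μ T) ε - reCharFun (centredGaussian σ) ε) ≤
        2 * (C * Real.exp (-T)) := by
      refine (le_abs_self _).trans ?_
      rw [abs_mul, hs, one_mul]
      exact (abs_reCharFun_sub_le_tvDistance _ _ ε).trans (by linarith [hrate T hT])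
    have h3 : Real.exp T * Real.exp (-T) = 1 := by rw [← Real.exp_add]; simp
    calc _ ≤ Real.exp T * (2 * (C * Real.exp (-T))) :=
          mul_le_mul_of_nonneg_left h1 (Real.exp_pos T).le
      _ = 2 * C := by linear_combination 2 * C * h3
  have hlim : Filter.Tendsto (fun T : ℝ => c * ε ^ n * Real.exp ((1 / 2) ^ (n + 1) * T))
      Filter.atTop Filter.atTop := by
    refine (Real.tendsto_exp_atTop.comp ?_).const_mul_atTop (by positivity)
    exact Filter.tendsto_id.const_mul_atTop (by positivity)
  obtain ⟨T, hT0, hT⟩ := ((Filter.eventually_ge_atTop 0).and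
    (hlim.eventually_gt_atTop (2 * C))).exists
  exact absurd (hbound T hT0) (not_le.2 hT)

/-! ### Moments, Taylor expansion and determinacy -/

theorem memLp_id_of_integrable_pow {P : Measure ℝ} [IsProbabilityMeasure P]
    (h : ∀ n : ℕ, Integrable (fun x : ℝ => x ^ n) P) (k : ℕ) : MemLp id k P := by
  rcases eq_or_ne k 0 with rfl | hk
  · simpa using aestronglyMeasurable_id
  · rw [← integrable_norm_rpow_iff aestronglyMeasurable_id (by simpa using hk) (by simp)]
    simpa using (h k).norm

theorem contDiff_reCharFun (P : Measure ℝ) [IsProbabilityMeasure P]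
    (h : ∀ n : ℕ, Integrable (fun x : ℝ => x ^ n) P) (n : ℕ) : ContDiff ℝ n (reCharFun P) :=
  Complex.reCLM.contDiff.comp (contDiff_charFun (memLp_id_of_integrable_pow h n))

theorem iteratedDeriv_reCharFun (P : Measure ℝ) [IsProbabilityMeasure P]
    (h : ∀ n : ℕ, Integrable (fun x : ℝ => x ^ n) P) (n : ℕ) (ξ : ℝ) :
    iteratedDeriv n (reCharFun P) ξ =
      (Complex.I ^ n * ∫ x : ℝ, (x : ℂ) ^ n * Complex.exp (ξ * x * Complex.I) ∂P).re := by
  rw [← iteratedDeriv_charFun (memLp_id_of_integrable_pow h n)]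
  have := Complex.reCLM.iteratedFDeriv_comp_left (f := charFun P) (x := ξ) (i := n) (n := n)
    (contDiff_charFun (memLp_id_of_integrable_pow h n)).contDiffAt le_rfl
  exact congrArg (fun F => F fun _ => 1) this

theorem iteratedDeriv_reCharFun_zero (P : Measure ℝ) [IsProbabilityMeasure P]
    (h : ∀ n : ℕ, Integrable (fun x : ℝ => x ^ n) P) (k : ℕ) :
    iteratedDeriv (2 * k) (reCharFun P) 0 = (-1) ^ k * ∫ x, x ^ (2 * k) ∂P := by
  have h1 : ∫ x : ℝ, (x : ℂ) ^ (2 * k) ∂P = ((∫ x, x ^ (2 * k) ∂P : ℝ) : ℂ) := by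
    rw [← integral_complex_ofReal]
    push_cast
    rfl
  rw [iteratedDeriv_reCharFun P h, pow_mul, Complex.I_sq]
  simp only [Complex.ofReal_zero, zero_mul, Complex.exp_zero, mul_one]
  rw [h1, show ((-1 : ℂ)) ^ k = (((-1 : ℝ) ^ k : ℝ) : ℂ) by push_cast; rfl,
    Complex.re_ofReal_mul, Complex.ofReal_re]

theorem abs_iteratedDeriv_reCharFun_le (P : Measure ℝ) [IsProbabilityMeasure P]
    (h : ∀ n : ℕ, Integrable (fun x : ℝ => x ^ n) P) (k : ℕ) (ξ : ℝ) :
    |iteratedDeriv (2 * k) (reCharFun P) ξ| ≤ ∫ x, x ^ (2 * k) ∂P := by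
  rw [iteratedDeriv_reCharFun P h]
  refine (Complex.abs_re_le_norm _).trans ?_
  rw [norm_mul, norm_pow, Complex.norm_I, one_pow, one_mul]
  refine (norm_integral_le_integral_norm _).trans_eq ?_
  congr 1 with x
  rw [norm_mul, show (ξ : ℂ) * x * Complex.I = ((ξ * x : ℝ) : ℂ) * Complex.I by push_cast; ring,
    Complex.norm_exp_ofReal_mul_I, mul_one, norm_pow, Complex.norm_real, Real.norm_eq_abs,
    pow_mul, sq_abs, pow_mul]

/-- A law with exponential moments is determined, up to symmetrization, by the derivatives at `0` of
the real part of its characteristic function. -/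
theorem reCharFun_eq_of_iteratedDeriv_eq {P Q : Measure ℝ} [IsProbabilityMeasure P]
    [IsProbabilityMeasure Q] (hP : ∀ n : ℕ, Integrable (fun x : ℝ => x ^ n) P)
    (hQ : ∀ n : ℕ, Integrable (fun x : ℝ => x ^ n) Q)
    (hexp : ∀ a : ℝ, Integrable (fun x : ℝ => Real.exp (a * x)) Q)
    (h : ∀ n, iteratedDeriv n (reCharFun P - reCharFun Q) 0 = 0) :
    reCharFun P = reCharFun Q := by
  funext ξ
  rcases eq_or_ne ξ 0 with rfl | hξ
  · rw [reCharFun_zero, reCharFun_zero]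
  set w := reCharFun P - reCharFun Q with hw
  have hwc : ∀ n : ℕ, ContDiff ℝ n w := fun n =>
    (contDiff_reCharFun P hP n).sub (contDiff_reCharFun Q hQ n)
  have hder : ∀ n x, iteratedDeriv n w x =
      iteratedDeriv n (reCharFun P) x - iteratedDeriv n (reCharFun Q) x := fun n x =>
    iteratedDeriv_sub (contDiff_reCharFun P hP n).contDiffAt
      (contDiff_reCharFun Q hQ n).contDiffAt
  have hmom : ∀ k, ∫ x, x ^ (2 * k) ∂P = ∫ x, x ^ (2 * k) ∂Q := by
    intro k
    have h1 := h (2 * k)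
    rw [hder, iteratedDeriv_reCharFun_zero P hP, iteratedDeriv_reCharFun_zero Q hQ,
      ← mul_sub] at h1
    have := (mul_eq_zero.1 h1).resolve_left (by simp)
    linarith
  -- The exponent `2|ξ|` instead of `|ξ|` produces the geometric factor `(1/4)^(k+1)` in the Taylor
  -- remainder.
  set E := ∫ x, (Real.exp (2 * |ξ| * x) + Real.exp (-(2 * |ξ|) * x)) ∂Q with hE
  have hmomE : ∀ k, (2 * |ξ|) ^ (2 * k) / (2 * k).factorial * ∫ x, x ^ (2 * k) ∂Q ≤ E := by
    intro k
    rw [← integral_const_mul]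
    refine integral_mono ((hQ _).const_mul _) ((hexp _).add (hexp _)) fun x => ?_
    have h1 := Real.pow_div_factorial_le_exp (2 * |ξ| * |x|) (by positivity) (2 * k)
    have h2 : (2 * |ξ|) ^ (2 * k) / (2 * k).factorial * x ^ (2 * k) =
        (2 * |ξ| * |x|) ^ (2 * k) / (2 * k).factorial := by
      rw [mul_pow _ |x|, pow_mul |x|, sq_abs, ← pow_mul]
      ring
    simp only
    rw [h2]
    refine h1.trans ?_
    rcases abs_cases x with ⟨hx, _⟩ | ⟨hx, _⟩ <;> rw [hx]
    · linarith [Real.exp_pos (-(2 * |ξ|) * x)]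
    · rw [show 2 * |ξ| * -x = -(2 * |ξ|) * x by ring]
      linarith [Real.exp_pos (2 * |ξ| * x)]
  have hrem : ∀ k : ℕ, |w ξ| ≤ 2 * E * (1 / 4) ^ (k + 1) := by
    intro k
    -- Degree `2k + 1` leaves a remainder of even order, controlled by an even moment, which is the
    -- same for `P` and `Q`.
    obtain ⟨y, -, hy⟩ := taylor_mean_remainder_lagrange_iteratedDeriv (f := w) (n := 2 * k + 1)
      hξ.symm (by exact_mod_cast (hwc (2 * k + 1 + 1)).contDiffOn)
    have hT : taylorWithinEval w (2 * k + 1) (Set.uIcc 0 ξ) 0 ξ = 0 := by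
      rw [taylor_within_apply]
      refine Finset.sum_eq_zero fun j _ => ?_
      rw [iteratedDerivWithin_eq_iteratedDeriv (uniqueDiffOn_uIcc hξ.symm) (hwc j).contDiffAt
        Set.left_mem_uIcc, h, smul_zero]
    rw [hT, sub_zero, sub_zero, show 2 * k + 1 + 1 = 2 * (k + 1) by ring] at hy
    have hb : |iteratedDeriv (2 * (k + 1)) w y| ≤ 2 * ∫ x, x ^ (2 * (k + 1)) ∂Q := by
      rw [hder]
      refine (abs_sub _ _).trans ?_
      have h1 := abs_iteratedDeriv_reCharFun_le P hP (k + 1) y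
      have h2 := abs_iteratedDeriv_reCharFun_le Q hQ (k + 1) y
      rw [hmom] at h1
      linarith
    have h4 : (1 / 4 : ℝ) ^ (k + 1) * (2 * |ξ|) ^ (2 * (k + 1)) = |ξ| ^ (2 * (k + 1)) := by
      rw [pow_mul, pow_mul, ← mul_pow]
      congr 1
      ring
    rw [hy, abs_div, abs_mul, abs_pow, Nat.abs_cast]
    calc _ ≤ (2 * ∫ x, x ^ (2 * (k + 1)) ∂Q) * |ξ| ^ (2 * (k + 1)) / (2 * (k + 1)).factorial := by
          gcongr
      _ = 2 * (1 / 4) ^ (k + 1) * ((2 * |ξ|) ^ (2 * (k + 1)) / (2 * (k + 1)).factorial *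
          ∫ x, x ^ (2 * (k + 1)) ∂Q) := by
          rw [← h4]; ring
      _ ≤ 2 * (1 / 4) ^ (k + 1) * E := by
          gcongr
          exact hmomE (k + 1)
      _ = _ := by ring
  have hlim : Filter.Tendsto (fun k : ℕ => 2 * E * (1 / 4 : ℝ) ^ (k + 1)) Filter.atTop
      (nhds 0) := by
    have := ((Filter.tendsto_add_atTop_iff_nat 1).2
      (tendsto_pow_atTop_nhds_zero_of_lt_one (r := (1 / 4 : ℝ)) (by norm_num)
        (by norm_num))).const_mul (2 * E)
    simpa using this
  have h0 : |w ξ| ≤ 0 := ge_of_tendsto' hlim hrem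
  exact sub_eq_zero.1 (abs_nonpos_iff.1 h0)

/-- An even function whose first nonvanishing derivative at `0` has order `n` is bounded away from
zero, with constant sign, by a multiple of `|x| ^ n` near `0`. -/
theorem exists_const_sign_lower_bound {f : ℝ → ℝ} {n : ℕ} (hf : ContDiff ℝ n f)
    (heven : ∀ x, f (-x) = f x) (hlt : ∀ j < n, iteratedDeriv j f 0 = 0)
    (hn : iteratedDeriv n f 0 ≠ 0) :
    ∃ δ c s : ℝ, 0 < δ ∧ 0 < c ∧ |s| = 1 ∧ ∀ x, |x| ≤ δ → c * |x| ^ n ≤ s * f x := by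
  set D := iteratedDeriv n f 0 with hD
  obtain ⟨s, hs, hsD⟩ : ∃ s : ℝ, |s| = 1 ∧ s * D = |D| := by
    rcases abs_cases D with ⟨h, _⟩ | ⟨h, _⟩
    · exact ⟨1, by simp, by simp [h]⟩
    · exact ⟨-1, by simp, by simp [h]⟩
  have hT : ∀ x, taylorWithinEval f n Set.univ 0 x = D / n.factorial * x ^ n := by
    intro x
    rw [taylor_within_apply, Finset.sum_range_succ, Finset.sum_eq_zero, zero_add,
      iteratedDerivWithin_univ, smul_eq_mul, sub_zero]
    · ring
    · intro j hj
      rw [iteratedDerivWithin_univ, hlt j (Finset.mem_range.1 hj), smul_zero]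
  -- Half the leading coefficient: the remainder may consume the other half.
  have hc : 0 < |D| / (2 * n.factorial) := by positivity
  have ho := (taylor_isLittleO_univ (x₀ := 0) hf).def hc
  obtain ⟨ε, hε, hball⟩ := Metric.eventually_nhds_iff.1 ho
  refine ⟨ε / 2, _, s, by positivity, hc, hs, fun x hx => ?_⟩
  -- Passing to `|x|` makes the leading term positive up to `s`, whatever the parity of `n`.
  have hfx : f x = f |x| := by
    rcases abs_cases x with ⟨h, _⟩ | ⟨h, _⟩ <;> rw [h]
    exact (heven x).symm
  have h1 := hball (y := |x|) (by rw [Real.dist_eq, sub_zero, abs_abs]; linarith)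
  rw [hT, sub_zero, norm_pow, Real.norm_eq_abs, Real.norm_eq_abs, abs_abs] at h1
  have h2 : |s * (f |x| - D / n.factorial * |x| ^ n)| ≤ |D| / (2 * n.factorial) * |x| ^ n := by
    rwa [abs_mul, hs, one_mul]
  have h3 := (abs_le.1 h2).1
  have h4 : s * (D / n.factorial * |x| ^ n) = 2 * (|D| / (2 * n.factorial) * |x| ^ n) := by
    rw [← hsD]
    field_simp
  rw [hfx]
  linarith

/-! ### Symmetrization and conclusion -/

theorem symmetrized_apply (μ : ProbabilityMeasure ℝ) {A : Set ℝ} (hA : MeasurableSet A) :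
    symmetrized μ A = 2⁻¹ * ((μ : Measure ℝ) A + (μ : Measure ℝ) (-A)) := by
  rw [symmetrized, Measure.smul_apply, Measure.add_apply, Measure.map_apply measurable_neg hA,
    smul_eq_mul]
  rfl

theorem charFun_symmetrized (μ : ProbabilityMeasure ℝ) (ξ : ℝ) :
    charFun (symmetrized μ) ξ = reCharFun μ ξ := by
  have hint : ∀ (P : Measure ℝ) [IsProbabilityMeasure P],
      Integrable (fun x : ℝ => Complex.exp (ξ * x * Complex.I)) P := fun P _ => by
    refine (integrable_const (1 : ℝ)).mono' (by fun_prop) (Filter.Eventually.of_forall fun x => ?_)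
    rw [show (ξ : ℂ) * x * Complex.I = ((ξ * x : ℝ) : ℂ) * Complex.I by push_cast; ring,
      Complex.norm_exp_ofReal_mul_I]
  have hneg : charFun ((μ : Measure ℝ).map fun x => -x) ξ = charFun (μ : Measure ℝ) (-ξ) := by
    have := charFun_map_mul (μ := (μ : Measure ℝ)) (-1) ξ
    simpa using this
  have : IsProbabilityMeasure ((μ : Measure ℝ).map fun x => -x) :=
    Measure.isProbabilityMeasure_map (by fun_prop)
  have hadd : charFun (symmetrized μ) ξ = 2⁻¹ * (charFun (μ : Measure ℝ) ξ +
      charFun ((μ : Measure ℝ).map fun x => -x) ξ) := by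
    simp only [charFun_apply_real, symmetrized]
    rw [integral_smul_measure, integral_add_measure (hint _) (hint _)]
    simp [mul_add]
  rw [hadd, hneg, charFun_neg, Complex.add_conj, reCharFun]
  push_cast
  ring

theorem proposition4 (μ₀ : ProbabilityMeasure ℝ) (μ : ℝ → ProbabilityMeasure ℝ) (σ : ℝ≥0)
    (hmom : ∀ n : ℕ, Integrable (fun x : ℝ => x ^ n) (μ₀ : Measure ℝ))
    (hsol : IsKacSolution μ₀ μ)
    (hrate : ∃ C : ℝ, 0 < C ∧
      ∀ t : ℝ, 0 ≤ t → tvDistance (μ t) (centredGaussian σ) ≤ C * Real.exp (-t)) :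
    (∃ o : SignedMeasure ℝ,
      (μ₀ : Measure ℝ).toSignedMeasure = (centredGaussian σ : Measure ℝ).toSignedMeasure + o ∧
      ∀ A : Set ℝ, MeasurableSet A →
        o A = -o (-A) ∧ 0 ≤ (centredGaussian σ : Measure ℝ).real A + o A) ∧
    symmetrized μ₀ = (centredGaussian σ : Measure ℝ) := by
  obtain ⟨C, -, hC⟩ := hrate
  have hexp : ∀ a : ℝ, Integrable (fun x : ℝ => Real.exp (a * x))
      (centredGaussian σ : Measure ℝ) := fun a => integrable_exp_mul_gaussianReal a
  have hgmom : ∀ n : ℕ, Integrable (fun x : ℝ => x ^ n) (centredGaussian σ : Measure ℝ) := by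
    intro n
    have h : MemLp id (n : ℝ≥0) (centredGaussian σ : Measure ℝ) := memLp_id_gaussianReal n
    exact (MemLp.integrable_norm_pow' (p := n) (by simpa using h)).mono'
      (by fun_prop) (Filter.Eventually.of_forall fun x => by simp)
  have heq : reCharFun μ₀ = reCharFun (centredGaussian σ) := by
    refine reCharFun_eq_of_iteratedDeriv_eq hmom hgmom hexp fun n => ?_
    -- With all lower derivatives zero, a nonzero `n`-th one would be a deviation of the excluded
    -- kind.
    induction n using Nat.strong_induction_on with
    | _ n ih =>
      by_contra hn
      obtain ⟨δ, c, s, hδ, hc, hs, hlow⟩ := exists_const_sign_lower_bound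
        ((contDiff_reCharFun _ hmom n).sub (contDiff_reCharFun _ hgmom n))
        (fun x => by simp [reCharFun_neg]) ih hn
      exact hsol.not_deviation (hmom 2) hC hδ hc hs hlow
  have hsym : symmetrized μ₀ = (centredGaussian σ : Measure ℝ) := by
    have : IsFiniteMeasure (symmetrized μ₀) := ⟨by
      rw [symmetrized_apply μ₀ MeasurableSet.univ]
      finiteness⟩
    refine Measure.ext_of_charFun ?_
    funext ξ
    rw [charFun_symmetrized, heq, reCharFun_centredGaussian, charFun_centredGaussian]
  refine ⟨⟨(μ₀ : Measure ℝ).toSignedMeasure - (centredGaussian σ : Measure ℝ).toSignedMeasure,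
    by abel, fun A hA => ?_⟩, hsym⟩
  -- This gives `o(A) = (μ₀(A) - μ₀(-A)) / 2`, which is antisymmetric; positivity holds because `γ +
  -- o = μ₀`.
  have hreal : ∀ B : Set ℝ, MeasurableSet B → (centredGaussian σ : Measure ℝ).real B =
      ((μ₀ : Measure ℝ).real B + (μ₀ : Measure ℝ).real (-B)) / 2 := by
    intro B hB
    rw [← hsym, measureReal_def, symmetrized_apply μ₀ hB, ENNReal.toReal_mul,
      ENNReal.toReal_add (by finiteness) (by finiteness), measureReal_def, measureReal_def]
    simp
    ring
  have h1 := hreal A hA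
  have h2 := hreal (-A) hA.neg
  rw [neg_neg] at h2
  have hpos : 0 ≤ (μ₀ : Measure ℝ).real A := measureReal_nonneg
  simp only [sub_apply, Measure.toSignedMeasure_apply_measurable hA,
    Measure.toSignedMeasure_apply_measurable hA.neg]
  constructor <;> linarith
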